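/- An \emph{algebraic theory} (Lawvere theory) is a category $\mathcal T$ whose objects are distinct objects $T^0,T^1,T^2,\dots$, equipped with projections $\pi^n_i\colon T^n\to T^1$ ($1\le i\le n$) that make $T^n$ the $n$-th power of $T^1$ for every $n\ge 0$, with $\pi^1_1=\mathrm{id}_{T^1}$. A \emph{morphism} of algebraic theories $\mathcal S\to\mathcal T$ is a functor that sends $S^n$ to $T^n$ for all $n$ and sends projections to the corresponding projections. The algebraic theory \emph{presented} by a set of finitary function symbols and a set of identities has as arrows $T^m\to T^n$ the $n$-tuples of terms in $m$ variables, modulo componentwise equality provable from the identities (the congruence on terms generated by all substitution instances of the identities); composition is substitution, and the projections are the variables. The \emph{theory of racks} is presented by two binary operations $s_x(y)$ and $s_x^{-1}(y)$ with the identities $$s_x^{-1}(s_x(y))=y=s_x(s_x^{-1}(y)),\qquad s_x(s_y(z))=s_{s_x(y)}(s_x(z)).$$ The \emph{theory of GL-quandles} (generalized Legendrian quandles) is presented by the same two binary operations together with two unary operations $\mathtt u$ and $\mathtt u^{-1}$, with the above identities and $$s_x(x)=x,\qquad \mathtt u^{-1}(\mathtt u(x))=x=\mathtt u(\mathtt u^{-1}(x)),\qquad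 \mathtt u(s_x(y))=s_{\mathtt u(x)}(\mathtt u(y))=s_x(\mathtt u(y)).$$ \textbf{Corollary.} In the category of algebraic theories, the theory of racks and the theory of GL-quandles are isomorphic. -/

import Mathlib

open CategoryTheory CategoryTheory.Limits

universe v

/-- The formal symbol `T^n` (for a natural number `n`), an object of an algebraic theory.
A wrapper around `ℕ`, so that the order category structure on `ℕ` plays no role. -/
structure FormalPower where
  /-- the exponent -/
  exp : ℕ

/-- An algebraic theory in the sense of Lawvere: a category whose objects are
`T^0, T^1, T^2, …`, in which `T^n` is the `n`-th power of `T^1` by means of specified projections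
`T^n ⟶ T^1`; the projection of `T^1` to its only factor is the identity. Equivalently, an
identity-on-objects finite product preserving functor from the opposite of the skeleton of finite
sets to a category. -/
structure LawvereTheory where
  /-- the category structure on the objects `T^n` -/
  [cat : Category.{v} FormalPower]
  /-- the `i`-th projection `T^n ⟶ T^1` -/
  proj (n : ℕ) (i : Fin n) : (FormalPower.mk n ⟶ FormalPower.mk 1)
  proj_one : proj 1 0 = 𝟙 (FormalPower.mk 1)
  isPower (n : ℕ) : Nonempty (IsLimit (Fan.mk (FormalPower.mk n) (proj n)))

namespace LawvereTheory

/-- The arrows `T^m ⟶ T^n` of an algebraic theory. -/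
def Arrow (T : LawvereTheory.{v}) (m n : ℕ) : Type v :=
  T.cat.Hom ⟨m⟩ ⟨n⟩

/-- The identity arrow of `T^n`. -/
def idArrow (T : LawvereTheory.{v}) (n : ℕ) : T.Arrow n n :=
  T.cat.id ⟨n⟩

/-- Composition of arrows, in diagrammatic order. -/
def compArrow (T : LawvereTheory.{v}) {m n k : ℕ} (f : T.Arrow m n) (g : T.Arrow n k) :
    T.Arrow m k :=
  T.cat.comp f g

/-- A morphism of algebraic theories: a functor sending `S^n` to `T^n` and projections to
projections (so that it preserves finite powers). -/
@[ext]
structure Hom (S T : LawvereTheory.{v}) where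
  /-- the action on arrows -/
  map {m n : ℕ} : S.Arrow m n → T.Arrow m n
  map_id (n : ℕ) : map (S.idArrow n) = T.idArrow n
  map_comp {m n k : ℕ} (f : S.Arrow m n) (g : S.Arrow n k) :
    map (S.compArrow f g) = T.compArrow (map f) (map g)
  map_proj (n : ℕ) (i : Fin n) : map (S.proj n i : S.Arrow n 1) = T.proj n i

/-- The category of algebraic theories. -/
instance : Category LawvereTheory.{v} where
  Hom S T := Hom S T
  id S :=
    { map := fun f => f
      map_id := fun _ => rfl
      map_comp := fun _ _ => rfl
      map_proj := fun _ _ => rfl }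
  comp F G :=
    { map := fun f => G.map (F.map f)
      map_id := fun n => by rw [F.map_id, G.map_id]
      map_comp := fun f g => by rw [F.map_comp, G.map_comp]
      map_proj := fun n i => by rw [F.map_proj, G.map_proj] }

end LawvereTheory

section EquationalTheory

open FirstOrder.Language

/-- Equality of terms provable from a set `E` of identities (pairs of terms, whose variables are
indexed by `ℕ`): the congruence on terms generated by all substitution instances of `E`. -/
inductive ProvablyEq {L : FirstOrder.Language.{0, 0}} (E : Set (L.Term ℕ × L.Term ℕ)) {X : Type} :
    L.Term X → L.Term X → Prop
  | ax {s t : L.Term ℕ} (h : (s, t) ∈ E) (σ : ℕ → L.Term X) :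
      ProvablyEq E (s.subst σ) (t.subst σ)
  | refl (t : L.Term X) : ProvablyEq E t t
  | symm {s t : L.Term X} : ProvablyEq E s t → ProvablyEq E t s
  | trans {s t r : L.Term X} : ProvablyEq E s t → ProvablyEq E t r → ProvablyEq E s r
  | congr {k : ℕ} (f : L.Functions k) {ts us : Fin k → L.Term X} :
      (∀ i, ProvablyEq E (ts i) (us i)) → ProvablyEq E (Term.func f ts) (Term.func f us)

theorem FirstOrder.Language.Term.subst_var' {L : FirstOrder.Language.{0, 0}} {X : Type} (t : L.Term X) :
    t.subst (fun x => Term.var x) = t := by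
  induction t with
  | var x => rfl
  | func f ts ih => simp only [Term.subst, ih]

theorem FirstOrder.Language.Term.subst_subst' {L : FirstOrder.Language.{0, 0}} {X Y Z : Type} (t : L.Term X)
    (σ : X → L.Term Y) (τ : Y → L.Term Z) :
    (t.subst σ).subst τ = t.subst (fun x => (σ x).subst τ) := by
  induction t with
  | var x => rfl
  | func f ts ih => simp only [Term.subst, ih]

namespace ProvablyEq

variable {L : FirstOrder.Language.{0, 0}} {E : Set (L.Term ℕ × L.Term ℕ)} {X Y : Type}

theorem subst_left {s t : L.Term X} (h : ProvablyEq E s t) (σ : X → L.Term Y) :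
    ProvablyEq E (s.subst σ) (t.subst σ) := by
  induction h with
  | ax h τ =>
    rw [Term.subst_subst', Term.subst_subst']
    exact ax h _
  | refl t => exact refl _
  | symm _ ih => exact ih.symm
  | trans _ _ ih₁ ih₂ => exact ih₁.trans ih₂
  | congr f _ ih => exact congr f ih

theorem subst_right (t : L.Term X) {σ τ : X → L.Term Y} (h : ∀ x, ProvablyEq E (σ x) (τ x)) :
    ProvablyEq E (t.subst σ) (t.subst τ) := by
  induction t with
  | var x => exact h x
  | func f ts ih => exact congr f ih

theorem subst {s t : L.Term X} (h : ProvablyEq E s t) {σ τ : X → L.Term Y}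
    (h' : ∀ x, ProvablyEq E (σ x) (τ x)) : ProvablyEq E (s.subst σ) (t.subst τ) :=
  (h.subst_left σ).trans (subst_right t h')

end ProvablyEq

/-- Componentwise provable equality of `n`-tuples of terms in `m` variables. -/
def tupleSetoid {L : FirstOrder.Language.{0, 0}} (E : Set (L.Term ℕ × L.Term ℕ)) (m n : ℕ) :
    Setoid (Fin n → L.Term (Fin m)) where
  r a b := ∀ i, ProvablyEq E (a i) (b i)
  iseqv :=
    { refl := fun a i => .refl (a i)
      symm := fun h i => (h i).symm
      trans := fun h h' i => (h i).trans (h' i) }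

/-- The category of an equational presentation: arrows `T^m ⟶ T^n` are `n`-tuples of terms in `m`
variables modulo provable equality, and composition is substitution. -/
abbrev syntacticCategory {L : FirstOrder.Language.{0, 0}} (E : Set (L.Term ℕ × L.Term ℕ)) :
    Category.{0} FormalPower where
  Hom a b := Quotient (tupleSetoid E a.exp b.exp)
  id a := Quotient.mk (tupleSetoid E a.exp a.exp) fun i => Term.var i
  comp {a b c} f g :=
    Quotient.map₂ (sa := tupleSetoid E a.exp b.exp) (sb := tupleSetoid E b.exp c.exp)
      (sc := tupleSetoid E a.exp c.exp) (fun s t i => (t i).subst s)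
      (fun _ _ hs _ _ ht i => (ht i).subst hs) f g
  id_comp {a b} f := by
    induction f using Quotient.inductionOn with
    | h s => exact congrArg (Quotient.mk _) (funext fun i => Term.subst_var' (s i))
  comp_id {a b} f := by
    induction f using Quotient.inductionOn with
    | h s => rfl
  assoc {a b c d} f g h := by
    induction f using Quotient.inductionOn with
    | h s =>
    induction g using Quotient.inductionOn with
    | h t =>
    induction h using Quotient.inductionOn with
    | h r =>
      exact congrArg (Quotient.mk _) (funext fun i => (Term.subst_subst' (r i) t s).symm)

/-- The algebraic theory presented by the function symbols of `L` and the set `E` of identities. -/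
def LawvereTheory.presentedBy {L : FirstOrder.Language.{0, 0}} (E : Set (L.Term ℕ × L.Term ℕ)) :
    LawvereTheory.{0} where
  cat := syntacticCategory E
  proj n i := Quotient.mk (tupleSetoid E n 1) fun _ => Term.var i
  proj_one := congrArg (Quotient.mk (tupleSetoid E 1 1)) (funext fun i => by
    rw [Subsingleton.elim i 0])
  isPower n := by
    let _ := syntacticCategory E
    refine ⟨Fan.IsLimit.mk _
      (fun s => Quotient.mk (tupleSetoid E s.pt.exp n) fun i =>
        Quotient.out (s := tupleSetoid E s.pt.exp 1) (s.proj i) 0) ?_ ?_⟩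
    · intro s i
      refine Eq.trans ?_ (Quotient.out_eq (s := tupleSetoid E s.pt.exp 1) (s.proj i))
      refine congrArg (Quotient.mk (tupleSetoid E s.pt.exp 1)) (funext fun j => ?_)
      rw [Subsingleton.elim j 0]
      rfl
    · intro s f hf
      induction f using Quotient.inductionOn with
      | h t =>
        refine Quotient.sound (s := tupleSetoid E s.pt.exp n) fun i => ?_
        have h := (hf i).trans
          (Quotient.out_eq (s := tupleSetoid E s.pt.exp 1) (s.proj i)).symm
        exact Quotient.exact (s := tupleSetoid E s.pt.exp 1) h 0

/-- The operations of racks: `act x y` is `s_x(y)` and `invAct x y` is `s_x⁻¹(y)`. -/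
inductive RackOp : ℕ → Type
  | act : RackOp 2
  | invAct : RackOp 2

/-- The algebraic signature of racks. -/
def rackLang : FirstOrder.Language.{0, 0} := ⟨RackOp, fun _ => Empty⟩

/-- The term `s_x(y)`. -/
def rackLang.s {X : Type} (x y : rackLang.Term X) : rackLang.Term X :=
  Functions.apply₂ (L := rackLang) RackOp.act x y

/-- The term `s_x⁻¹(y)`. -/
def rackLang.sInv {X : Type} (x y : rackLang.Term X) : rackLang.Term X :=
  Functions.apply₂ (L := rackLang) RackOp.invAct x y

open rackLang in
/-- The identities defining racks: each `s_x` is a bijection with inverse `s_x⁻¹`, and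
`s_x s_y = s_{s_x(y)} s_x`. -/
def rackAxioms : Set (rackLang.Term ℕ × rackLang.Term ℕ) :=
  let x : rackLang.Term ℕ := Term.var 0
  let y : rackLang.Term ℕ := Term.var 1
  let z : rackLang.Term ℕ := Term.var 2
  {(sInv x (s x y), y),
   (s x (sInv x y), y),
   (s x (s y z), s (s x y) (s x z))}

/-- The operations of GL-quandles: `act x y` is `s_x(y)`, `invAct x y` is `s_x⁻¹(y)`, and `u`,
`uInv` are the GL-structure and its inverse. -/
inductive GLQuandleOp : ℕ → Type
  | act : GLQuandleOp 2
  | invAct : GLQuandleOp 2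
  | u : GLQuandleOp 1
  | uInv : GLQuandleOp 1

/-- The algebraic signature of GL-quandles. -/
def glQuandleLang : FirstOrder.Language.{0, 0} := ⟨GLQuandleOp, fun _ => Empty⟩

/-- The term `s_x(y)`. -/
def glQuandleLang.s {X : Type} (x y : glQuandleLang.Term X) : glQuandleLang.Term X :=
  Functions.apply₂ (L := glQuandleLang) GLQuandleOp.act x y

/-- The term `s_x⁻¹(y)`. -/
def glQuandleLang.sInv {X : Type} (x y : glQuandleLang.Term X) : glQuandleLang.Term X :=
  Functions.apply₂ (L := glQuandleLang) GLQuandleOp.invAct x y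

/-- The term `u(x)`. -/
def glQuandleLang.u {X : Type} (x : glQuandleLang.Term X) : glQuandleLang.Term X :=
  Functions.apply₁ (L := glQuandleLang) GLQuandleOp.u x

/-- The term `u⁻¹(x)`. -/
def glQuandleLang.uInv {X : Type} (x : glQuandleLang.Term X) : glQuandleLang.Term X :=
  Functions.apply₁ (L := glQuandleLang) GLQuandleOp.uInv x

open glQuandleLang in
/-- The identities defining GL-quandles: the three rack identities, the quandle identity
`s_x(x) = x`, and those saying that `u` is a bijection with inverse `u⁻¹`, a rack endomorphism
(`u s_x = s_{u(x)} u`), and commutes with every `s_x`. -/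
def glQuandleAxioms : Set (glQuandleLang.Term ℕ × glQuandleLang.Term ℕ) :=
  let x : glQuandleLang.Term ℕ := Term.var 0
  let y : glQuandleLang.Term ℕ := Term.var 1
  let z : glQuandleLang.Term ℕ := Term.var 2
  {(sInv x (s x y), y),
   (s x (sInv x y), y),
   (s x (s y z), s (s x y) (s x z)),
   (s x x, x),
   (uInv (u x), x),
   (u (uInv x), x),
   (u (s x y), s (u x) (u y)),
   (u (s x y), s x (u y))}

/-- The algebraic theory of racks. -/
def rackTheory : LawvereTheory.{0} := LawvereTheory.presentedBy rackAxioms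

/-- The algebraic theory of GL-quandles. -/
def glQuandleTheory : LawvereTheory.{0} := LawvereTheory.presentedBy glQuandleAxioms

end EquationalTheory

/-! In a rack put `u(x) = s_x(x)`. This map is bijective with inverse `x ↦ s_x⁻¹(x)`, commutes with
every translation (translations are automorphisms), and `u(x)` acts exactly as `x` does. Hence the
twisted translations `s_x u⁻¹` form a quandle on which `u` is a GL-structure. Conversely, in a
GL-quandle the maps `u s_x` form a rack, since `u` is central among the translations and `s_{u(x)} =
s_x`. Its diagonal is `u(s_x(x)) = u(x)` by idempotence, so the two constructions undo each other.

Both constructions are given by terms, so they are interpretations of signatures. Sound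
interpretations that are mutually inverse modulo the identities give an isomorphism of theories
(`presentedByIso`). The required derivations become equations in free models, where rack and quandle
algebra applies. -/

open FirstOrder.Language

/-! ### Interpretations between equational presentations -/

section Interpretation

/-- An interpretation of one signature in the terms of another: each function symbol of arity `k`
is assigned a term in `k` variables. -/
def SymbolInterpretation (L M : FirstOrder.Language.{0, 0}) : Type :=
  ∀ k : ℕ, L.Functions k → M.Term (Fin k)

namespace SymbolInterpretation

variable {L M : FirstOrder.Language.{0, 0}} {X Y : Type}

/-- The translation of terms along an interpretation of the function symbols. -/
def translate (I : SymbolInterpretation L M) : L.Term X → M.Term X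
  | .var x => .var x
  | .func (l := k) f ts => (I k f).subst fun i => I.translate (ts i)

/-- Needed twice: for substitution instances of identities, and for functoriality, since composition
is substitution. -/
theorem translate_subst (I : SymbolInterpretation L M) (t : L.Term X) (σ : X → L.Term Y) :
    I.translate (t.subst σ) = (I.translate t).subst fun x => I.translate (σ x) := by
  induction t with
  | var x => rfl
  | func f ts ih => simp only [Term.subst, translate, ih, Term.subst_subst']

/-- An interpretation is sound if it turns identities into provable identities. -/
def IsSound (I : SymbolInterpretation L M) (E : Set (L.Term ℕ × L.Term ℕ))
    (F : Set (M.Term ℕ × M.Term ℕ)) : Prop :=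
  ∀ e ∈ E, ProvablyEq F (I.translate e.1) (I.translate e.2)

variable {E : Set (L.Term ℕ × L.Term ℕ)} {F : Set (M.Term ℕ × M.Term ℕ)}

theorem IsSound.translate_provablyEq {I : SymbolInterpretation L M} (hI : I.IsSound E F)
    {s t : L.Term X} (h : ProvablyEq E s t) :
    ProvablyEq F (I.translate s) (I.translate t) := by
  induction h with
  | ax h σ =>
    rw [translate_subst, translate_subst]
    exact (hI _ h).subst_left _
  | refl t => exact .refl _
  | symm _ ih => exact ih.symm
  | trans _ _ ih₁ ih₂ => exact ih₁.trans ih₂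
  | congr f _ ih => exact ProvablyEq.subst_right _ ih

/-- The morphism of presented theories induced by a sound interpretation. -/
def IsSound.hom {I : SymbolInterpretation L M} (hI : I.IsSound E F) :
    LawvereTheory.presentedBy E ⟶ LawvereTheory.presentedBy F where
  map {m n} := Quotient.map (sa := tupleSetoid E m n) (sb := tupleSetoid F m n)
    (fun t i => I.translate (t i)) fun _ _ h i => hI.translate_provablyEq (h i)
  map_id _ := rfl
  map_comp {m n k} f g := by
    induction f using Quotient.inductionOn with
    | h s =>
    induction g using Quotient.inductionOn with
    | h t =>
      exact congrArg (Quotient.mk (tupleSetoid F m k))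
        (funext fun i => translate_subst I (t i) s)
  map_proj _ _ := rfl

/-- `J` undoes `I` modulo the identities `E`. -/
def IsLeftInverse (J : SymbolInterpretation M L) (I : SymbolInterpretation L M)
    (E : Set (L.Term ℕ × L.Term ℕ)) : Prop :=
  ∀ (k : ℕ) (f : L.Functions k),
    ProvablyEq E (J.translate (I k f)) (Term.func f fun i => Term.var i)

/-- Induction on the term reduces the round trip to the basic operations applied to variables. -/
theorem IsLeftInverse.translate_translate {J : SymbolInterpretation M L}
    {I : SymbolInterpretation L M} (h : J.IsLeftInverse I E) (t : L.Term X) :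
    ProvablyEq E (J.translate (I.translate t)) t := by
  induction t with
  | var x => exact .refl _
  | func f ts ih =>
    rw [translate, translate_subst]
    exact (h _ f).subst ih

theorem IsLeftInverse.hom_comp_hom {J : SymbolInterpretation M L} {I : SymbolInterpretation L M}
    (h : J.IsLeftInverse I E) (hI : I.IsSound E F) (hJ : J.IsSound F E) :
    hI.hom ≫ hJ.hom = 𝟙 (LawvereTheory.presentedBy E) := by
  refine LawvereTheory.Hom.ext ?_
  funext m n f
  induction f using Quotient.inductionOn with
  | h t => exact Quotient.sound (s := tupleSetoid E m n) fun i => h.translate_translate (t i)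

/-- Mutually inverse sound interpretations give an isomorphism of presented theories. -/
def presentedByIso {I : SymbolInterpretation L M} {J : SymbolInterpretation M L}
    (hI : I.IsSound E F) (hJ : J.IsSound F E) (hJI : J.IsLeftInverse I E)
    (hIJ : I.IsLeftInverse J F) :
    LawvereTheory.presentedBy E ≅ LawvereTheory.presentedBy F where
  hom := hI.hom
  inv := hJ.hom
  hom_inv_id := hJI.hom_comp_hom hI hJ
  inv_hom_id := hIJ.hom_comp_hom hJ hI

end SymbolInterpretation

end Interpretation

/-! ### Free models: derivability as equality -/

section FreeModel

/-- Provable equality as a setoid on terms. -/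
def provableSetoid {L : FirstOrder.Language.{0, 0}} (E : Set (L.Term ℕ × L.Term ℕ)) (X : Type) :
    Setoid (L.Term X) where
  r := ProvablyEq E
  iseqv := ⟨.refl, .symm, .trans⟩

/-- Terms modulo provable equality: the free model on `X`. -/
def FreeModel {L : FirstOrder.Language.{0, 0}} (E : Set (L.Term ℕ × L.Term ℕ)) (X : Type) : Type :=
  Quotient (provableSetoid E X)

namespace FreeModel

variable {L : FirstOrder.Language.{0, 0}} {E : Set (L.Term ℕ × L.Term ℕ)} {X : Type}

/-- The class of a term in the free model. -/
def mk (E : Set (L.Term ℕ × L.Term ℕ)) (t : L.Term X) : FreeModel E X :=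
  Quotient.mk (provableSetoid E X) t

theorem mk_eq_mk {s t : L.Term X} : mk E s = mk E t ↔ ProvablyEq E s t :=
  ⟨fun h => Quotient.exact (s := provableSetoid E X) h,
    fun h => Quotient.sound (s := provableSetoid E X) h⟩

theorem ind {p : FreeModel E X → Prop} (h : ∀ t, p (mk E t)) (a : FreeModel E X) : p a :=
  Quotient.ind h a

/-- The unary operation on the free model given by a function symbol. -/
def op₁ (f : L.Functions 1) : FreeModel E X → FreeModel E X :=
  Quotient.map (sa := provableSetoid E X) (sb := provableSetoid E X) (Functions.apply₁ f)
    fun _ _ h => .congr f fun i => by rw [Subsingleton.elim i 0]; exact h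

/-- The binary operation on the free model given by a function symbol. -/
def op₂ (f : L.Functions 2) : FreeModel E X → FreeModel E X → FreeModel E X :=
  Quotient.map₂ (sa := provableSetoid E X) (sb := provableSetoid E X) (sc := provableSetoid E X)
    (Functions.apply₂ f) fun _ _ h _ _ h' => .congr f (Fin.forall_fin_two.2 ⟨h, h'⟩)

/-- The assignment of three terms to the first three variables. -/
def assign (a b c : L.Term X) : ℕ → L.Term X
  | 0 => a
  | 1 => b
  | _ => c

theorem mk_subst_eq {s t : L.Term ℕ} (h : (s, t) ∈ E) (σ : ℕ → L.Term X) :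
    mk E (s.subst σ) = mk E (t.subst σ) :=
  mk_eq_mk.2 (.ax h σ)

/-- Puts the generic term occurring in `IsLeftInverse` into the form of an operation on generators.
-/
theorem mk_func₁ (f : L.Functions 1) :
    mk E (Term.func f fun i => Term.var i) = op₁ f (mk E (Term.var 0)) :=
  congrArg (fun ts => mk E (Term.func f ts)) (funext fun i => by rw [Subsingleton.elim i 0]; rfl)

theorem mk_func₂ (f : L.Functions 2) :
    mk E (Term.func f fun i => Term.var i) = op₂ f (mk E (Term.var 0)) (mk E (Term.var 1)) :=
  congrArg (fun ts => mk E (Term.func f ts)) (funext (Fin.forall_fin_two.2 ⟨rfl, rfl⟩))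

end FreeModel

theorem FirstOrder.Language.Functions.apply₁_subst {L : FirstOrder.Language.{0, 0}} {X Y : Type}
    (f : L.Functions 1) (a : L.Term X) (σ : X → L.Term Y) :
    (f.apply₁ a).subst σ = f.apply₁ (a.subst σ) :=
  congrArg (Term.func f) (funext fun i => by rw [Subsingleton.elim i 0]; rfl)

theorem FirstOrder.Language.Functions.apply₂_subst {L : FirstOrder.Language.{0, 0}} {X Y : Type}
    (f : L.Functions 2) (a b : L.Term X) (σ : X → L.Term Y) :
    (f.apply₂ a b).subst σ = f.apply₂ (a.subst σ) (b.subst σ) :=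
  congrArg (Term.func f) (funext (Fin.forall_fin_two.2 ⟨rfl, rfl⟩))

theorem SymbolInterpretation.translate_apply₁ {L M : FirstOrder.Language.{0, 0}} {X : Type}
    (I : SymbolInterpretation L M) (f : L.Functions 1) (a : L.Term X) :
    I.translate (f.apply₁ a) = (I 1 f).subst fun _ => I.translate a :=
  congrArg (I 1 f).subst (funext fun i => by rw [Subsingleton.elim i 0]; rfl)

theorem SymbolInterpretation.translate_apply₂ {L M : FirstOrder.Language.{0, 0}} {X : Type}
    (I : SymbolInterpretation L M) (f : L.Functions 2) (a b : L.Term X) :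
    I.translate (f.apply₂ a b) = (I 2 f).subst ![I.translate a, I.translate b] :=
  congrArg (I 2 f).subst (funext (Fin.forall_fin_two.2 ⟨rfl, rfl⟩))

end FreeModel

/-! ### Racks and GL-quandles as free models -/

section Racks

open Quandles

namespace rackLang

variable {X Y : Type}

theorem subst_s (a b : rackLang.Term X) (σ : X → rackLang.Term Y) :
    (s a b).subst σ = s (a.subst σ) (b.subst σ) :=
  Functions.apply₂_subst _ a b σ

theorem subst_sInv (a b : rackLang.Term X) (σ : X → rackLang.Term Y) :
    (sInv a b).subst σ = sInv (a.subst σ) (b.subst σ) :=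
  Functions.apply₂_subst _ a b σ

end rackLang

/-- The free model of the identities of racks is a rack. -/
instance FreeModel.instRack (X : Type) : Rack (FreeModel rackAxioms X) where
  act := op₂ (L := rackLang) RackOp.act
  invAct := op₂ (L := rackLang) RackOp.invAct
  self_distrib {a b c} := by
    induction a using ind with | h a =>
    induction b using ind with | h b =>
    induction c using ind with | h c =>
    have h := mk_subst_eq (E := rackAxioms) (Or.inr (Or.inr rfl)) (assign a b c)
    simp only [rackLang.subst_s] at h
    exact h
  left_inv a b := by
    induction a using ind with | h a =>
    induction b using ind with | h b =>
    -- The third variable does not occur in this identity, so its value is arbitrary.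
    have h := mk_subst_eq (E := rackAxioms) (Or.inl rfl) (assign a b b)
    simp only [rackLang.subst_s, rackLang.subst_sInv] at h
    exact h
  right_inv a b := by
    induction a using ind with | h a =>
    induction b using ind with | h b =>
    have h := mk_subst_eq (E := rackAxioms) (Or.inr (Or.inl rfl)) (assign a b b)
    simp only [rackLang.subst_s, rackLang.subst_sInv] at h
    exact h

namespace rackLang

variable {X : Type}

theorem mk_s (a b : rackLang.Term X) :
    FreeModel.mk rackAxioms (s a b) = FreeModel.mk rackAxioms a ◃ FreeModel.mk rackAxioms b :=
  rfl

theorem mk_sInv (a b : rackLang.Term X) :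
    FreeModel.mk rackAxioms (sInv a b) =
      FreeModel.mk rackAxioms a ◃⁻¹ FreeModel.mk rackAxioms b :=
  rfl

end rackLang

/-- A GL-quandle: a quandle with an automorphism that commutes with all left translations. -/
class GLQuandle (Q : Type) extends Quandle Q where
  /-- the GL-structure -/
  u : Q → Q
  /-- the inverse of the GL-structure -/
  uInv : Q → Q
  uInv_u (a : Q) : uInv (u a) = a
  u_uInv (a : Q) : u (uInv a) = a
  u_act (a b : Q) : u (a ◃ b) = u a ◃ u b
  u_act_right (a b : Q) : u (a ◃ b) = a ◃ u b

namespace GLQuandle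

variable {Q : Type} [GLQuandle Q]

theorem act_u (a b : Q) : a ◃ u b = u (a ◃ b) :=
  (u_act_right a b).symm

/-- The two laws for `u` give `u a ◃ u c = a ◃ u c`, and `u` is surjective: take `c = uInv b`. -/
theorem u_act_left (a b : Q) : u a ◃ b = a ◃ b := by
  have h := (u_act a (uInv b)).symm.trans (u_act_right a (uInv b))
  rwa [u_uInv] at h

theorem invAct_u (a b : Q) : a ◃⁻¹ u b = u (a ◃⁻¹ b) := by
  rw [← Rack.left_cancel a, Rack.right_inv, act_u, Rack.right_inv]

theorem act_uInv (a b : Q) : a ◃ uInv b = uInv (a ◃ b) := by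
  rw [← uInv_u (a ◃ uInv b), ← act_u, u_uInv]

theorem invAct_self (a : Q) : a ◃⁻¹ a = a := by
  rw [← Rack.left_cancel a, Rack.right_inv, Quandle.fix]

end GLQuandle

namespace glQuandleLang

variable {X Y : Type}

theorem subst_s (a b : glQuandleLang.Term X) (σ : X → glQuandleLang.Term Y) :
    (s a b).subst σ = s (a.subst σ) (b.subst σ) :=
  Functions.apply₂_subst _ a b σ

theorem subst_sInv (a b : glQuandleLang.Term X) (σ : X → glQuandleLang.Term Y) :
    (sInv a b).subst σ = sInv (a.subst σ) (b.subst σ) :=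
  Functions.apply₂_subst _ a b σ

theorem subst_u (a : glQuandleLang.Term X) (σ : X → glQuandleLang.Term Y) :
    (u a).subst σ = u (a.subst σ) :=
  Functions.apply₁_subst _ a σ

theorem subst_uInv (a : glQuandleLang.Term X) (σ : X → glQuandleLang.Term Y) :
    (uInv a).subst σ = uInv (a.subst σ) :=
  Functions.apply₁_subst _ a σ

end glQuandleLang

open glQuandleLang in
/-- The free model of the identities of GL-quandles is a GL-quandle. -/
instance FreeModel.instGLQuandle (X : Type) : GLQuandle (FreeModel glQuandleAxioms X) where
  act := op₂ (L := glQuandleLang) GLQuandleOp.act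
  invAct := op₂ (L := glQuandleLang) GLQuandleOp.invAct
  u := op₁ (L := glQuandleLang) GLQuandleOp.u
  uInv := op₁ (L := glQuandleLang) GLQuandleOp.uInv
  left_inv a b := by
    induction a using ind with | h a =>
    induction b using ind with | h b =>
    have h := mk_subst_eq (E := glQuandleAxioms) (.inl rfl) (assign a b b)
    simp only [subst_s, subst_sInv] at h
    exact h
  right_inv a b := by
    induction a using ind with | h a =>
    induction b using ind with | h b =>
    have h := mk_subst_eq (E := glQuandleAxioms) (.inr (.inl rfl)) (assign a b b)
    simp only [subst_s, subst_sInv] at h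
    exact h
  self_distrib {a b c} := by
    induction a using ind with | h a =>
    induction b using ind with | h b =>
    induction c using ind with | h c =>
    have h := mk_subst_eq (E := glQuandleAxioms) (.inr (.inr (.inl rfl))) (assign a b c)
    simp only [subst_s] at h
    exact h
  fix {a} := by
    induction a using ind with | h a =>
    have h := mk_subst_eq (E := glQuandleAxioms) (.inr (.inr (.inr (.inl rfl)))) (assign a a a)
    simp only [subst_s] at h
    exact h
  uInv_u a := by
    induction a using ind with | h a =>
    have h := mk_subst_eq (E := glQuandleAxioms) (.inr (.inr (.inr (.inr (.inl rfl)))))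
      (assign a a a)
    simp only [subst_u, subst_uInv] at h
    exact h
  u_uInv a := by
    induction a using ind with | h a =>
    have h := mk_subst_eq (E := glQuandleAxioms) (.inr (.inr (.inr (.inr (.inr (.inl rfl))))))
      (assign a a a)
    simp only [subst_u, subst_uInv] at h
    exact h
  u_act a b := by
    induction a using ind with | h a =>
    induction b using ind with | h b =>
    have h := mk_subst_eq (E := glQuandleAxioms)
      (.inr (.inr (.inr (.inr (.inr (.inr (.inl rfl))))))) (assign a b b)
    simp only [subst_u, subst_s] at h
    exact h
  u_act_right a b := by
    induction a using ind with | h a =>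
    induction b using ind with | h b =>
    have h := mk_subst_eq (E := glQuandleAxioms)
      (.inr (.inr (.inr (.inr (.inr (.inr (.inr rfl))))))) (assign a b b)
    simp only [subst_u, subst_s] at h
    exact h

namespace glQuandleLang

variable {X : Type}

theorem mk_s (a b : glQuandleLang.Term X) :
    FreeModel.mk glQuandleAxioms (s a b) =
      FreeModel.mk glQuandleAxioms a ◃ FreeModel.mk glQuandleAxioms b :=
  rfl

theorem mk_sInv (a b : glQuandleLang.Term X) :
    FreeModel.mk glQuandleAxioms (sInv a b) =
      FreeModel.mk glQuandleAxioms a ◃⁻¹ FreeModel.mk glQuandleAxioms b :=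
  rfl

theorem mk_u (a : glQuandleLang.Term X) :
    FreeModel.mk glQuandleAxioms (u a) = GLQuandle.u (FreeModel.mk glQuandleAxioms a) :=
  rfl

theorem mk_uInv (a : glQuandleLang.Term X) :
    FreeModel.mk glQuandleAxioms (uInv a) = GLQuandle.uInv (FreeModel.mk glQuandleAxioms a) :=
  rfl

end glQuandleLang

/-! ### The two twisting interpretations -/

open glQuandleLang in
/-- The rack operations in a GL-quandle: `(x, y) ↦ u(s_x(y))` and its inverse. -/
def rackInterpretation : SymbolInterpretation rackLang glQuandleLang
  | _, RackOp.act => u (s (Term.var 0) (Term.var 1))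
  | _, RackOp.invAct => uInv (sInv (Term.var 0) (Term.var 1))

open rackLang in
/-- The GL-quandle operations in a rack: `u(x) = s_x(x)`, and the operation of the rack is twisted
by the inverse of `u`. -/
def glQuandleInterpretation : SymbolInterpretation glQuandleLang rackLang
  | _, GLQuandleOp.act => s (Term.var 0) (sInv (Term.var 1) (Term.var 1))
  -- The inverse of `s_x u⁻¹` is `u s_x⁻¹`; it is written here as `s_x⁻¹ u`, the two being equal
  -- because `u` commutes with translations.
  | _, GLQuandleOp.invAct => sInv (Term.var 0) (s (Term.var 1) (Term.var 1))
  | _, GLQuandleOp.u => s (Term.var 0) (Term.var 0)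
  | _, GLQuandleOp.uInv => sInv (Term.var 0) (Term.var 0)

section Translate

variable {X : Type}

theorem translate_rack_s (a b : rackLang.Term X) :
    rackInterpretation.translate (rackLang.s a b) =
      glQuandleLang.u (glQuandleLang.s (rackInterpretation.translate a)
        (rackInterpretation.translate b)) := by
  refine (SymbolInterpretation.translate_apply₂ _ _ a b).trans ?_
  simp only [rackInterpretation, glQuandleLang.subst_s, glQuandleLang.subst_u]
  rfl

theorem translate_rack_sInv (a b : rackLang.Term X) :
    rackInterpretation.translate (rackLang.sInv a b) =
      glQuandleLang.uInv (glQuandleLang.sInv (rackInterpretation.translate a)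
        (rackInterpretation.translate b)) := by
  refine (SymbolInterpretation.translate_apply₂ _ _ a b).trans ?_
  simp only [rackInterpretation, glQuandleLang.subst_sInv, glQuandleLang.subst_uInv]
  rfl

theorem translate_glQuandle_s (a b : glQuandleLang.Term X) :
    glQuandleInterpretation.translate (glQuandleLang.s a b) =
      rackLang.s (glQuandleInterpretation.translate a)
        (rackLang.sInv (glQuandleInterpretation.translate b)
          (glQuandleInterpretation.translate b)) := by
  refine (SymbolInterpretation.translate_apply₂ _ _ a b).trans ?_
  simp only [glQuandleInterpretation, rackLang.subst_s, rackLang.subst_sInv]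
  rfl

theorem translate_glQuandle_sInv (a b : glQuandleLang.Term X) :
    glQuandleInterpretation.translate (glQuandleLang.sInv a b) =
      rackLang.sInv (glQuandleInterpretation.translate a)
        (rackLang.s (glQuandleInterpretation.translate b)
          (glQuandleInterpretation.translate b)) := by
  refine (SymbolInterpretation.translate_apply₂ _ _ a b).trans ?_
  simp only [glQuandleInterpretation, rackLang.subst_s, rackLang.subst_sInv]
  rfl

theorem translate_glQuandle_u (a : glQuandleLang.Term X) :
    glQuandleInterpretation.translate (glQuandleLang.u a) =
      rackLang.s (glQuandleInterpretation.translate a) (glQuandleInterpretation.translate a) := by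
  refine (SymbolInterpretation.translate_apply₁ _ _ a).trans ?_
  simp only [glQuandleInterpretation, rackLang.subst_s]
  rfl

theorem translate_glQuandle_uInv (a : glQuandleLang.Term X) :
    glQuandleInterpretation.translate (glQuandleLang.uInv a) =
      rackLang.sInv (glQuandleInterpretation.translate a)
        (glQuandleInterpretation.translate a) := by
  refine (SymbolInterpretation.translate_apply₁ _ _ a).trans ?_
  simp only [glQuandleInterpretation, rackLang.subst_sInv]
  rfl

end Translate

/-! ### Soundness -/

theorem rackInterpretation_isSound : rackInterpretation.IsSound rackAxioms glQuandleAxioms := by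
  rintro e (rfl | rfl | rfl) <;> rw [← FreeModel.mk_eq_mk] <;>
    simp only [translate_rack_s, translate_rack_sInv, glQuandleLang.mk_s, glQuandleLang.mk_sInv,
      glQuandleLang.mk_u, glQuandleLang.mk_uInv]
  · rw [GLQuandle.invAct_u, GLQuandle.uInv_u, Rack.left_inv]
  · rw [GLQuandle.act_uInv, GLQuandle.u_uInv, Rack.right_inv]
  -- Every `u` moves to the outside or disappears from an acting position, leaving `u²` on both
  -- sides of self-distributivity.
  · simp only [GLQuandle.act_u, GLQuandle.u_act_left]
    rw [Shelf.self_distrib]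

/-- Translation by `a` is a rack automorphism, so it commutes with `u⁻¹ : x ↦ x ◃⁻¹ x`. -/
theorem Rack.act_invAct_self {R : Type} [Rack R] (a b : R) :
    a ◃ (b ◃⁻¹ b) = (a ◃ b) ◃⁻¹ (a ◃ b) := by
  rw [← Rack.left_cancel (a ◃ b), Rack.right_inv, ← Shelf.self_distrib, Rack.right_inv]

/-- This is `u⁻¹ s_a⁻¹ u = s_a⁻¹`, checked after applying `s_a`. -/
theorem Rack.invAct_act_self_untwist {R : Type} [Rack R] (a b : R) :
    (a ◃⁻¹ (b ◃ b)) ◃⁻¹ (a ◃⁻¹ (b ◃ b)) = a ◃⁻¹ b := by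
  rw [← Rack.left_cancel a, Rack.act_invAct_self, Rack.right_inv, Rack.right_inv,
    Rack.self_act_invAct_eq, Rack.left_inv]

theorem glQuandleInterpretation_isSound :
    glQuandleInterpretation.IsSound glQuandleAxioms rackAxioms := by
  rintro e (rfl | rfl | rfl | rfl | rfl | rfl | rfl | rfl) <;> rw [← FreeModel.mk_eq_mk] <;>
    simp only [translate_glQuandle_s, translate_glQuandle_sInv, translate_glQuandle_u,
      translate_glQuandle_uInv, rackLang.mk_s, rackLang.mk_sInv]
  · rw [← Shelf.self_distrib, Rack.left_inv, Rack.self_invAct_act_eq, Rack.right_inv]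
  · rw [Rack.act_invAct_self, Rack.right_inv, Rack.self_act_invAct_eq, Rack.left_inv]
  -- Each `u⁻¹` is pulled outwards through translations and dropped where it acts, since `u⁻¹(x)`
  -- acts as `x`.
  · simp only [Rack.act_invAct_self, Rack.self_invAct_act_eq]
    rw [Shelf.self_distrib]
  · rw [Rack.right_inv]
  · rw [Rack.self_act_invAct_eq, Rack.left_inv]
  · rw [Rack.self_invAct_act_eq, Rack.right_inv]
  · rw [← Shelf.self_distrib, Rack.self_invAct_act_eq, Rack.right_inv, Rack.self_act_act_eq,
      Rack.self_act_invAct_eq, Rack.left_inv]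
  · rw [← Shelf.self_distrib, Rack.self_invAct_act_eq, Rack.right_inv,
      Rack.self_act_invAct_eq, Rack.left_inv]

/-! ### The interpretations are mutually inverse -/

theorem glQuandleInterpretation_isLeftInverse :
    glQuandleInterpretation.IsLeftInverse rackInterpretation rackAxioms := by
  rintro _ (_ | _) <;> rw [← FreeModel.mk_eq_mk]
  · refine Eq.trans ?_ (FreeModel.mk_func₂ _).symm
    simp only [rackInterpretation, translate_glQuandle_s, translate_glQuandle_u, rackLang.mk_s,
      rackLang.mk_sInv, SymbolInterpretation.translate]
    rw [← Shelf.self_distrib, Rack.self_invAct_act_eq, Rack.right_inv]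
    rfl
  · refine Eq.trans ?_ (FreeModel.mk_func₂ _).symm
    simp only [rackInterpretation, translate_glQuandle_sInv, translate_glQuandle_uInv,
      rackLang.mk_s, rackLang.mk_sInv, SymbolInterpretation.translate]
    exact Rack.invAct_act_self_untwist _ _

theorem rackInterpretation_isLeftInverse :
    rackInterpretation.IsLeftInverse glQuandleInterpretation glQuandleAxioms := by
  rintro _ (_ | _ | _ | _) <;> rw [← FreeModel.mk_eq_mk] <;>
    simp only [glQuandleInterpretation, translate_rack_s, translate_rack_sInv,
      glQuandleLang.mk_s, glQuandleLang.mk_sInv, glQuandleLang.mk_u, glQuandleLang.mk_uInv,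
      SymbolInterpretation.translate]
  -- Idempotence collapses the diagonal of the twisted rack to the given `u` or its inverse, here
  -- and in the remaining cases.
  · rw [GLQuandle.invAct_self, GLQuandle.act_uInv, GLQuandle.u_uInv]
    exact (FreeModel.mk_func₂ _).symm
  · rw [Quandle.fix, GLQuandle.invAct_u, GLQuandle.uInv_u]
    exact (FreeModel.mk_func₂ _).symm
  · rw [Quandle.fix]
    exact (FreeModel.mk_func₁ _).symm
  · rw [GLQuandle.invAct_self]
    exact (FreeModel.mk_func₁ _).symm

end Racks

theorem mainTheorem12 : Nonempty (rackTheory ≅ glQuandleTheory) :=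
  ⟨SymbolInterpretation.presentedByIso rackInterpretation_isSound glQuandleInterpretation_isSound
    glQuandleInterpretation_isLeftInverse rackInterpretation_isLeftInverse⟩
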